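/- A semigroup $(S,+)$ is called *inverse* if for every $x\in S$ there is a unique $x^*\in S$ such that $x+x^*+x=x$ and $x^*+x+x^*=x^*$. A *commutative simplicial inverse semigroup* is a simplicial object $S_\bullet$ in the category of semigroups such that every $S_k$ ($k\ge 0$) is a commutative inverse semigroup. The homotopy groups $\pi_n(X_\bullet,x)$ ($n\ge 1$) of a simplicial set $X_\bullet$ at a vertex $x\in X_0$ are the simplicial homotopy groups of a functorial fibrant replacement of $X_\bullet$ (the set of simplices $\Delta^n\to X$ sending $\partial\Delta^n$ to the base point, up to homotopy relative to $\partial\Delta^n$, with the usual group law). Let $S_\bullet$ be a commutative simplicial inverse semigroup, let $e\in S_0$ be an idempotent, i.e. $e+e=e$, and let $n\ge 1$ be an integer. Let $\boxplus$ be the operation on $\pi_n(S_\bullet,e)$ induced by the law $+\colon S_\bullet\times S_\bullet\to S_\bullet$, i.e. the composite $$\pi_n(S_\bullet,e)\times\pi_n(S_\bullet,e)\;\cong\;\pi_n(S_\bullet\times S_\bullet,(e,e))\;\xrightarrow{\ \pi_n(+)\ }\;\pi_n(S_\bullet,e+e)=\pi_n(S_\bullet,e),$$ where the bijection is the inverse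 of the map given by the two projections. Then $\boxplus$ coincides with the usual group law of the homotopy group: $a\boxplus b=a\cdot b$ for all $a,b\in\pi_n(S_\bullet,e)$. -/

import Mathlib

open CategoryTheory Simplicial
universe u

namespace SSet
section
open MonoidalCategory CartesianMonoidalCategory HomotopicalAlgebra Limits

/-- The simplices of `∂Δ[1]` are constant. -/
lemma bdryOne_const {m : SimplexCategoryᵒᵖ} (t : (∂Δ[1] : SSet.{u}).obj m)
    (i j : Fin (m.unop.len + 1)) :
    stdSimplex.asOrderHom t.1 i = stdSimplex.asOrderHom t.1 j := by
  by_contra hne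
  apply t.2
  intro k
  by_cases h : stdSimplex.asOrderHom t.1 i = k
  · exact ⟨i, h⟩
  · refine ⟨j, ?_⟩
    omega

/-- Two morphisms `X ⟶ K`, seen as one morphism on `∂Δ[1] ⊗ X`. -/
def glueEnds {X K : SSet.{u}} (a b : X ⟶ K) : (∂Δ[1] : SSet.{u}) ⊗ X ⟶ K where
  app m := ↾fun z ↦ if stdSimplex.asOrderHom z.1.1 0 = 0 then a.app m z.2 else b.app m z.2
  naturality m m' f := by
    ext ⟨t, s⟩
    have h := bdryOne_const t (f.unop.toOrderHom 0) 0
    have h' : stdSimplex.asOrderHom ((∂Δ[1] : SSet.{u}).map f t).1 0 =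
      stdSimplex.asOrderHom t.1 (f.unop.toOrderHom 0) := rfl
    change (if stdSimplex.asOrderHom ((∂Δ[1] : SSet.{u}).map f t).1 0 = 0 then
      a.app m' (X.map f s) else b.app m' (X.map f s)) = K.map f (if _ then _ else _)
    rw [h', h]
    split_ifs
    · exact NatTrans.naturality_apply a f s
    · exact NatTrans.naturality_apply b f s

/-- The inclusion of `X` as the end `t` of `Δ[1] ⊗ X`. -/
noncomputable def endIncl (X : SSet.{u}) (t : Fin 2) : X ⟶ Δ[1] ⊗ X :=
  lift (const (stdSimplex.obj₀Equiv.symm t)) (𝟙 X)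

lemma endIncl_comp {X Y : SSet.{u}} (f : X ⟶ Y) (t : Fin 2) :
    endIncl X t ≫ Δ[1] ◁ f = f ≫ endIncl Y t := rfl

/-- The restriction of a homotopy to `∂Δ[1] ⊗ X` is given by its two ends. -/
lemma endIncl_bdry {X K : SSet.{u}} (H : Δ[1] ⊗ X ⟶ K) :
    ∂Δ[1].ι ▷ X ≫ H = glueEnds (endIncl X 0 ≫ H) (endIncl X 1 ≫ H) := by
  ext m ⟨t, s⟩
  change H.app m (t.1, s) = if stdSimplex.asOrderHom t.1 0 = 0 then
    H.app m ((const (X := X) (Y := Δ[1]) (stdSimplex.obj₀Equiv.symm 0)).app m s, s) else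
      H.app m ((const (X := X) (Y := Δ[1]) (stdSimplex.obj₀Equiv.symm 1)).app m s, s)
  have key (k : Fin 2) (h : stdSimplex.asOrderHom t.1 0 = k) :
      t.1 = (const (X := X) (Y := Δ[1]) (stdSimplex.obj₀Equiv.symm k)).app m s := by
    apply (stdSimplex.objEquiv (n := ⦋1⦌) (m := m)).injective
    ext i : 3
    change stdSimplex.asOrderHom t.1 i = k
    rw [← h]; exact bdryOne_const t i 0
  split_ifs with h
  · rw [← key 0 h]
  · rw [← key 1 (Fin.eq_one_of_ne_zero _ h)]

lemma exists_endIncl_bdry (X : SSet.{u}) (t : Fin 2) : ∃ w : X ⟶ (∂Δ[1] : SSet.{u}) ⊗ X,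
    w ≫ ∂Δ[1].ι ▷ X = endIncl X t ∧
      ∀ {K : SSet.{u}} (u v : X ⟶ K), w ≫ glueEnds u v = if t = 0 then u else v := by
  have ht : stdSimplex.obj₀Equiv.symm t ∈ (∂Δ[1] : (Δ[1] : SSet.{u}).Subcomplex).obj _ := by
    rw [boundary_obj_eq_univ 0 1]; exact Set.mem_univ _
  refine ⟨lift (const ⟨stdSimplex.obj₀Equiv.symm t, ht⟩) (𝟙 X), ?_, fun u v ↦ ?_⟩
  · ext m s <;> rfl
  · ext m s
    change (if t = 0 then u.app m s else v.app m s) = _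
    split_ifs <;> rfl

/-- Homotopies with prescribed ends extend along anodyne extensions, if the target is Kan. -/
lemma exists_homotopy_extension {A B K : SSet.{u}} [KanComplex K] (i : A ⟶ B)
    (hi : anodyneExtensions i) (u v : B ⟶ K) (H : Δ[1] ⊗ A ⟶ K)
    (h0 : endIncl A 0 ≫ H = i ≫ u) (h1 : endIncl A 1 ≫ H = i ≫ v) :
    ∃ H' : Δ[1] ⊗ B ⟶ K, Δ[1] ◁ i ≫ H' = H ∧ endIncl B 0 ≫ H' = u ∧ endIncl B 1 ≫ H' = v := by
  have hp : HasLiftingProperty i ((MonoidalClosed.pre (∂Δ[1] : (Δ[1] : SSet.{u}).Subcomplex).ι).app K) :=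
    hi _ (by rw [← HomotopicalAlgebra.fibration_iff]; infer_instance)
  have sq : CommSq (MonoidalClosed.curry H) i
      ((MonoidalClosed.pre (∂Δ[1] : (Δ[1] : SSet.{u}).Subcomplex).ι).app K)
      (MonoidalClosed.curry (glueEnds u v)) := ⟨by
    rw [MonoidalClosed.curry_pre_app, ← MonoidalClosed.curry_natural_left, endIncl_bdry, h0, h1]
    rfl⟩
  have e1 : Δ[1] ◁ i ≫ MonoidalClosed.uncurry sq.lift = H := by
    rw [← MonoidalClosed.uncurry_natural_left, sq.fac_left, MonoidalClosed.uncurry_curry]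
  have e2 : ∂Δ[1].ι ▷ B ≫ MonoidalClosed.uncurry sq.lift = glueEnds u v := by
    rw [← MonoidalClosed.uncurry_pre_app, sq.fac_right, MonoidalClosed.uncurry_curry]
  refine ⟨MonoidalClosed.uncurry sq.lift, e1, ?_, ?_⟩
  · obtain ⟨w, hw, hw'⟩ := exists_endIncl_bdry B 0
    rw [← hw, Category.assoc, e2, hw']; rfl
  · obtain ⟨w, hw, hw'⟩ := exists_endIncl_bdry B 1
    rw [← hw, Category.assoc, e2, hw']; rfl


/-- The constant path at `x`, as a vertex of the path space. -/
noncomputable def constPath {K : SSet.{u}} (x : K _⦋0⦌) : ((ihom (Δ[1] : SSet.{u})).obj K) _⦋0⦌ :=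
  yonedaEquiv (MonoidalClosed.curry (snd Δ[1] Δ[0] ≫ const x))

lemma const_constPath {A K : SSet.{u}} (x : K _⦋0⦌) :
    (const (constPath x) : A ⟶ (ihom (Δ[1] : SSet.{u})).obj K) =
      MonoidalClosed.curry (snd Δ[1] A ≫ const x) := by
  have h : (const (constPath x) : Δ[0] ⟶ (ihom (Δ[1] : SSet.{u})).obj K) =
      MonoidalClosed.curry (snd Δ[1] Δ[0] ≫ const x) := by
    have e : constPath x = (MonoidalClosed.curry (snd Δ[1] Δ[0] ≫ const x)).app _
        (stdSimplex.obj₀Equiv.symm 0) := by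
      change (MonoidalClosed.curry (snd Δ[1] Δ[0] ≫ const x)).app _ _ = _
      congr 1
      exact stdSimplex.obj₀Equiv.injective (@Subsingleton.elim (Fin 1) _ _ _)
    have e2 : (const (stdSimplex.obj₀Equiv.symm 0) : Δ[0] ⟶ Δ[0]) = 𝟙 _ := stdSimplex.ext₀
    rw [e, ← const_comp, e2, Category.id_comp]
  have h2 : (const (constPath x) : A ⟶ (ihom (Δ[1] : SSet.{u})).obj K) =
    (const (stdSimplex.obj₀Equiv.symm 0) : A ⟶ Δ[0]) ≫ const (constPath x) := rfl
  rw [h2, h, ← MonoidalClosed.curry_natural_left]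
  rfl

lemma uncurry_const_constPath {A K : SSet.{u}} (x : K _⦋0⦌) :
    MonoidalClosed.uncurry (const (constPath x) : A ⟶ (ihom (Δ[1] : SSet.{u})).obj K) =
      snd Δ[1] A ≫ const x := by
  rw [const_constPath, MonoidalClosed.uncurry_curry]

namespace PtSimplex

variable {K : SSet.{u}} {x : K _⦋0⦌} {n : ℕ}

/-- A homotopy between pointed simplices is a pointed simplex of the path space. -/
lemma exists_path {f g : K.PtSimplex n x} (H : RelativeMorphism.Homotopy f g) :
    ∃ q : PtSimplex ((ihom (Δ[1] : SSet.{u})).obj K) n (constPath x),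
      endIncl _ 0 ≫ MonoidalClosed.uncurry q.map = f.map ∧
      endIncl _ 1 ≫ MonoidalClosed.uncurry q.map = g.map := by
  refine ⟨{ map := MonoidalClosed.curry ((β_ _ _).hom ≫ H.h), comm := ?_ }, ?_, ?_⟩
  · have h := H.rel
    rw [← MonoidalClosed.curry_natural_left]
    have h2 : (const ⟨constPath x, Subcomplex.mem_ofSimplex_obj _⟩ :
      (∂Δ[n] : SSet.{u}) ⟶ (Subcomplex.ofSimplex (constPath x) : SSet)) ≫
        (Subcomplex.ofSimplex (constPath x)).ι = const (constPath x) := rfl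
    rw [h2, const_constPath, BraidedCategory.braiding_naturality_right_assoc, h]
    rfl
  · rw [MonoidalClosed.uncurry_curry, ← H.h₀]; rfl
  · rw [MonoidalClosed.uncurry_curry, ← H.h₁]; rfl

/-- A pointed simplex of the path space is a homotopy between pointed simplices. -/
lemma nonempty_homotopy {f g : K.PtSimplex n x}
    (q : PtSimplex ((ihom (Δ[1] : SSet.{u})).obj K) n (constPath x))
    (h0 : endIncl _ 0 ≫ MonoidalClosed.uncurry q.map = f.map)
    (h1 : endIncl _ 1 ≫ MonoidalClosed.uncurry q.map = g.map) :
    Nonempty (RelativeMorphism.Homotopy f g) := by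
  refine ⟨{ h := (β_ _ _).hom ≫ MonoidalClosed.uncurry q.map, h₀ := ?_, h₁ := ?_, rel := ?_ }⟩
  · rw [← h0]; rfl
  · rw [← h1]; rfl
  · have h2 : (const ⟨constPath x, Subcomplex.mem_ofSimplex_obj _⟩ :
      (∂Δ[n] : SSet.{u}) ⟶ (Subcomplex.ofSimplex (constPath x) : SSet)) ≫
        (Subcomplex.ofSimplex (constPath x)).ι = const (constPath x) := rfl
    rw [BraidedCategory.braiding_naturality_left_assoc, ← MonoidalClosed.uncurry_natural_left,
      q.comm, h2, uncurry_const_constPath]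
    rfl

/-- A simplex whose faces are all constant. -/
def ofFaces (φ : Δ[n + 1] ⟶ K) (h : ∀ j, stdSimplex.δ j ≫ φ = const x) :
    K.PtSimplex (n + 1) x where
  map := φ
  comm := boundary.hom_ext fun j ↦ by
    rw [boundary.ι_ι_assoc, h]; rfl

/-- If all faces but one of a simplex are constant on their boundary, so is the last one. -/
lemma δ_δ_eq_const (φ : Δ[n + 2] ⟶ K) (i : Fin (n + 3))
    (h : ∀ (j : Fin (n + 3)) (_ : j ≠ i) (k : Fin (n + 2)),
      stdSimplex.δ k ≫ stdSimplex.δ j ≫ φ = const x) (k : Fin (n + 2)) :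
    stdSimplex.δ k ≫ stdSimplex.δ i ≫ φ = const x := by
  by_cases hk : k.castSucc < i
  · rw [← Category.assoc, stdSimplex.δ_comp_δ' hk, Category.assoc]
    exact h _ hk.ne _
  · rw [not_lt] at hk
    obtain ⟨i, rfl⟩ := i.eq_castSucc_of_ne_last (by rintro rfl; exact absurd hk (by simp))
    have hk' : i ≤ k := by simpa using hk
    rw [← Category.assoc, ← stdSimplex.δ_comp_δ hk', Category.assoc]
    refine h _ ?_ _
    intro e
    have e' := congrArg Fin.val e
    rw [Fin.val_succ, Fin.val_castSucc] at e'
    have := Fin.le_def.1 hk'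
    omega

/-- A family of pointed simplices can be filled along a horn of a Kan complex. -/
lemma exists_fill [KanComplex K] (i : Fin (n + 3)) (F : Fin (n + 3) → K.PtSimplex (n + 1) x) :
    ∃ (p : K.PtSimplex (n + 1) x) (φ : Δ[n + 2] ⟶ K),
      (∀ j, j ≠ i → stdSimplex.δ j ≫ φ = (F j).map) ∧ stdSimplex.δ i ≫ φ = p.map := by
  have hc : horn.IsCompatible (i := i) (fun j _ ↦ (F j).map) := by
    rw [horn.isCompatible_iff]
    intros
    rw [δ_map, δ_map]
  obtain ⟨φ, hφ⟩ := hc.exists_lift_of_kanComplex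
  refine ⟨ofFaces (stdSimplex.δ i ≫ φ) (δ_δ_eq_const φ i fun j hj k ↦ ?_), φ, hφ, rfl⟩
  rw [hφ j hj, δ_map]

end PtSimplex

namespace PtSimplex

variable {K : SSet.{u}} {x : K _⦋0⦌} {n : ℕ}

lemma exists_mulStruct [KanComplex K] (f g : K.PtSimplex (n + 1) x) (i : Fin (n + 1)) :
    ∃ fg : K.PtSimplex (n + 1) x, Nonempty (MulStruct f g fg i) := by
  obtain ⟨p, φ, hφ, hp⟩ := exists_fill (K := K) (x := x) i.castSucc.succ
    (fun j ↦ if j = i.castSucc.castSucc then g else if j = i.succ.succ then f else .const)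
  refine ⟨p, ⟨φ, ?_, ?_, ?_, ?_, ?_⟩⟩
  · rw [hφ _ (by simp [Fin.ext_iff]), if_pos rfl]
  · exact hp
  · rw [hφ _ (by simp [Fin.ext_iff]), if_neg (by grind), if_pos rfl]
  · intro j hj
    rw [hφ _ (by grind), if_neg (by grind), if_neg (by grind)]; rfl
  · intro j hj
    rw [hφ _ (by grind), if_neg (by grind), if_neg (by grind)]; rfl

lemma exists_leftInv [KanComplex K] (f : K.PtSimplex (n + 1) x) (i : Fin (n + 1)) :
    ∃ g : K.PtSimplex (n + 1) x, Nonempty (MulStruct g f .const i) := by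
  obtain ⟨p, φ, hφ, hp⟩ := exists_fill (K := K) (x := x) i.succ.succ
    (fun j ↦ if j = i.castSucc.castSucc then f else .const)
  refine ⟨p, ⟨φ, ?_, ?_, ?_, ?_, ?_⟩⟩
  · rw [hφ _ (by grind), if_pos rfl]
  · rw [hφ _ (by simp [Fin.ext_iff]), if_neg (by simp [Fin.ext_iff])]
  · exact hp
  · intro j hj
    rw [hφ _ (by grind), if_neg (by grind)]; rfl
  · intro j hj
    rw [hφ _ (by grind), if_neg (by grind)]; rfl

/-- The faces of the simplex of a `MulStruct`, indexed by natural numbers. -/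
noncomputable def mulFace (f g fg : K.PtSimplex n x) (i : ℕ) (j : ℕ) : Δ[n] ⟶ K :=
  if j = i then g.map else if j = i + 1 then fg.map else if j = i + 2 then f.map else const x

lemma MulStruct.δ_map {f g fg : K.PtSimplex n x} {i : Fin n} (m : MulStruct f g fg i)
    (j : Fin (n + 2)) : stdSimplex.δ j ≫ m.map = mulFace f g fg i j := by
  unfold mulFace
  split_ifs with h1 h2 h3
  · obtain rfl : j = i.castSucc.castSucc := Fin.ext h1
    exact m.δ_castSucc_castSucc_map
  · obtain rfl : j = i.castSucc.succ := Fin.ext h2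
    exact m.δ_succ_castSucc_map
  · obtain rfl : j = i.succ.succ := Fin.ext h3
    exact m.δ_succ_succ_map
  · by_cases h : j < i.castSucc.castSucc
    · exact m.δ_map_of_lt j h
    · exact m.δ_map_of_gt j (by grind)

/-- A simplex with the faces prescribed by `mulFace` gives a `MulStruct`. -/
lemma MulStruct.nonempty_of_faces {f g fg : K.PtSimplex n x} {i : Fin n} (φ : Δ[n + 1] ⟶ K)
    (h : ∀ j : Fin (n + 2), stdSimplex.δ j ≫ φ = mulFace f g fg i j) :
    Nonempty (MulStruct f g fg i) := by
  refine ⟨φ, ?_, ?_, ?_, ?_, ?_⟩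
  · rw [h]; simp [mulFace]
  · rw [h]; simp [mulFace]
  · rw [h]; unfold mulFace
    rw [if_neg (by grind), if_neg (by grind), if_pos (by grind)]
  · intro j hj; rw [h]; unfold mulFace
    rw [if_neg (by grind), if_neg (by grind), if_neg (by grind)]
  · intro j hj; rw [h]; unfold mulFace
    rw [if_neg (by grind), if_neg (by grind), if_neg (by grind)]

/-- The product of pointed simplices is associative. -/
lemma mulStruct_assoc [KanComplex K] {f g h fg gh fgh : K.PtSimplex (n + 1) x} {i : Fin (n + 1)}
    (m₁ : MulStruct f g fg i) (m₂ : MulStruct g h gh i) (m₃ : MulStruct fg h fgh i) :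
    Nonempty (MulStruct f gh fgh i) := by
  let F (j : Fin (n + 4)) : Δ[n + 2] ⟶ K :=
    if j.val = i.val then m₂.map else if j.val = i.val + 1 then m₃.map
      else if j.val = i.val + 3 then m₁.map else const x
  have hF (j : Fin (n + 4)) (k : Fin (n + 3)) : stdSimplex.δ k ≫ F j =
    if j.val = i.val then mulFace g h gh i k else if j.val = i.val + 1 then mulFace fg h fgh i k
      else if j.val = i.val + 3 then mulFace f g fg i k else const x := by
    dsimp only [F]
    split_ifs
    · exact m₂.δ_map k
    · exact m₃.δ_map k
    · exact m₁.δ_map k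
    · rfl
  let a : Fin (n + 4) := ⟨i.val + 2, by omega⟩
  have hc : horn.IsCompatible (i := a) (fun j _ ↦ F j) := by
    rw [horn.isCompatible_iff]
    intro j k hj hk hjk
    rw [hF, hF]
    have hcp : (j.castPred (Fin.ne_last_of_lt hjk)).val = j.val := rfl
    simp only [Fin.val_pred, hcp, mulFace]
    have hj' : j.val ≠ i.val + 2 := fun h ↦ hj (Fin.ext h)
    have hk' : k.val ≠ i.val + 2 := fun h ↦ hk (Fin.ext h)
    have hjk' : j.val < k.val := hjk
    clear hcp
    grind
  obtain ⟨φ, hφ⟩ := hc.exists_lift_of_kanComplex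
  refine MulStruct.nonempty_of_faces (stdSimplex.δ a ≫ φ) fun j ↦ ?_
  by_cases hj : j.castSucc < a
  · rw [← Category.assoc, stdSimplex.δ_comp_δ' hj, Category.assoc, hφ _ hj.ne, hF]
    have hj' : j.val < i.val + 2 := hj
    simp only [Fin.val_pred, Fin.val_castSucc, mulFace, a]
    grind
  · have ha : a = (⟨i.val + 2, by omega⟩ : Fin (n + 3)).castSucc := rfl
    have hj' : i.val + 2 ≤ j.val := by rw [not_lt] at hj; exact hj
    rw [← Category.assoc, ha, ← stdSimplex.δ_comp_δ (show _ ≤ j from hj'), Category.assoc,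
      hφ _ (by simp [a, Fin.ext_iff]; omega), hF]
    simp only [Fin.val_succ, mulFace]
    grind

/-- Products of homotopic pointed simplices are homotopic. -/
lemma mulStruct_congr [KanComplex K] {f g fg f' g' fg' : K.PtSimplex (n + 1) x} {i : Fin (n + 1)}
    (m : MulStruct f g fg i) (m' : MulStruct f' g' fg' i)
    (hf : Nonempty (RelativeMorphism.Homotopy f f'))
    (hg : Nonempty (RelativeMorphism.Homotopy g g')) :
    Nonempty (RelativeMorphism.Homotopy fg fg') := by
  obtain ⟨p, hp0, hp1⟩ := exists_path hf.some
  obtain ⟨q, hq0, hq1⟩ := exists_path hg.some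
  let F (j : Fin (n + 3)) : PtSimplex ((ihom (Δ[1] : SSet.{u})).obj K) (n + 1) (constPath x) :=
    if j.val = i.val then q else if j.val = i.val + 2 then p else .const
  let a : Fin (n + 3) := i.castSucc.succ
  have hc : horn.IsCompatible (i := a) (fun j _ ↦ (F j).map) := by
    rw [horn.isCompatible_iff]
    intros
    rw [PtSimplex.δ_map, PtSimplex.δ_map]
  have hends (t : Fin 2) (u v w : K.PtSimplex (n + 1) x) (mm : MulStruct u v w i)
      (hu : endIncl _ t ≫ MonoidalClosed.uncurry p.map = u.map)
      (hv : endIncl _ t ≫ MonoidalClosed.uncurry q.map = v.map) :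
      endIncl _ t ≫ MonoidalClosed.uncurry hc.desc = Λ[n + 2, a].ι ≫ mm.map := by
    apply horn.hom_ext'
    intro j hj
    rw [← Category.assoc, ← endIncl_comp, Category.assoc, ← MonoidalClosed.uncurry_natural_left,
      horn.IsCompatible.ι_desc, horn.ι_ι_assoc, mm.δ_map]
    have hj' : j.val ≠ i.val + 1 := fun h ↦ hj (Fin.ext h)
    dsimp only [F, mulFace]
    split_ifs
    · exact hv
    · exact hu
    · change endIncl _ t ≫ MonoidalClosed.uncurry (const (constPath x)) = _
      rw [uncurry_const_constPath]
      rfl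
  obtain ⟨H, hH, hH0, hH1⟩ := exists_homotopy_extension Λ[n + 2, a].ι
    (anodyneExtensions.horn_ι a) m.map m'.map (MonoidalClosed.uncurry hc.desc)
    (hends 0 _ _ _ m hp0 hq0) (hends 1 _ _ _ m' hp1 hq1)
  have hφ (j : Fin (n + 3)) (hj : j ≠ a) :
      stdSimplex.δ j ≫ MonoidalClosed.curry H = (F j).map := by
    rw [← hc.ι_desc j hj, ← horn.ι_ι a j hj, Category.assoc, ← MonoidalClosed.curry_natural_left,
      hH, MonoidalClosed.curry_uncurry]
  refine nonempty_homotopy (ofFaces (stdSimplex.δ a ≫ MonoidalClosed.curry H)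
    (δ_δ_eq_const _ a fun j hj k ↦ by rw [hφ j hj, PtSimplex.δ_map])) ?_ ?_
  · change endIncl _ 0 ≫ MonoidalClosed.uncurry (stdSimplex.δ a ≫ MonoidalClosed.curry H) = _
    rw [← MonoidalClosed.curry_natural_left, MonoidalClosed.uncurry_curry, ← Category.assoc,
      endIncl_comp, Category.assoc, hH0]
    exact m.δ_succ_castSucc_map
  · change endIncl _ 1 ≫ MonoidalClosed.uncurry (stdSimplex.δ a ≫ MonoidalClosed.curry H) = _
    rw [← MonoidalClosed.curry_natural_left, MonoidalClosed.uncurry_curry, ← Category.assoc,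
      endIncl_comp, Category.assoc, hH1]
    exact m'.δ_succ_castSucc_map

end PtSimplex


/-- The set of pointed simplices `Δ[n] ⟶ X` (which send `∂Δ[n]` to `x`), up to
homotopy relative to `∂Δ[n]`. It is the right homotopy set when `X` is a Kan complex. -/
def KanPi (X : SSet.{u}) (n : ℕ) (x : X _⦋0⦌) : Type u :=
  RelativeMorphism.HomotopyClass (boundary n) (Subcomplex.ofSimplex x)
    (const ⟨x, Subcomplex.mem_ofSimplex_obj x⟩)

/-- The vertex `(x, y)` of the product `X ⊗ Y`. -/
def pairVertex {X Y : SSet.{u}} (x : X _⦋0⦌) (y : Y _⦋0⦌) : (X ⊗ Y : SSet.{u}) _⦋0⦌ := (x, y)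

namespace KanPi

variable {K L : SSet.{u}} {n : ℕ}

/-- The class of a pointed simplex. -/
def mk {x : K _⦋0⦌} (f : K.PtSimplex n x) : KanPi K n x := RelativeMorphism.homotopyClass f

lemma mk_surjective {x : K _⦋0⦌} (a : KanPi K n x) : ∃ f, mk f = a := Quot.exists_rep a

/-- The map induced by a morphism of simplicial sets sending `x` to `y`. -/
def map (φ : K ⟶ L) {x : K _⦋0⦌} {y : L _⦋0⦌} (h : φ.app _ x = y) (a : KanPi K n x) :
    KanPi L n y :=
  RelativeMorphism.HomotopyClass.postcomp a (RelativeMorphism.ofSimplex₀ φ x y h) rfl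

/-- The product of two classes: if `σ : Δ[n + 2] ⟶ K` has its faces number `n`, `n + 1`, `n + 2`
equal to `g`, `fg`, `f` and all its other faces constant, then the product of the class of `f`
and of the class of `g` is the class of `fg`. Such a `σ` exists since `K` is a Kan complex. -/
noncomputable def mul [KanComplex K] {x : K _⦋0⦌} (a b : KanPi K (n + 1) x) : KanPi K (n + 1) x :=
  Quot.lift₂ (fun f g ↦ mk (PtSimplex.exists_mulStruct f g (Fin.last n)).choose)
    (fun f g g' hg ↦ (PtSimplex.mulStruct_congr
      (PtSimplex.exists_mulStruct f g (Fin.last n)).choose_spec.some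
      (PtSimplex.exists_mulStruct f g' (Fin.last n)).choose_spec.some
      ⟨.refl f⟩ hg).some.eq)
    (fun f f' g hf ↦ (PtSimplex.mulStruct_congr
      (PtSimplex.exists_mulStruct f g (Fin.last n)).choose_spec.some
      (PtSimplex.exists_mulStruct f' g (Fin.last n)).choose_spec.some
      hf ⟨.refl g⟩).some.eq) a b

noncomputable instance [KanComplex K] {x : K _⦋0⦌} : Mul (KanPi K (n + 1) x) := ⟨mul⟩

instance {x : K _⦋0⦌} : One (KanPi K n x) := ⟨mk .const⟩

lemma mk_mul_mk [KanComplex K] {x : K _⦋0⦌} {f g fg : K.PtSimplex (n + 1) x}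
    (m : PtSimplex.MulStruct f g fg (Fin.last n)) : mk f * mk g = mk fg :=
  (PtSimplex.mulStruct_congr (PtSimplex.exists_mulStruct f g (Fin.last n)).choose_spec.some m
    ⟨.refl f⟩ ⟨.refl g⟩).some.eq

lemma exists_inv [KanComplex K] {x : K _⦋0⦌} (a : KanPi K (n + 1) x) :
    ∃ b : KanPi K (n + 1) x, b * a = 1 := by
  obtain ⟨f, rfl⟩ := mk_surjective a
  obtain ⟨g, ⟨m⟩⟩ := PtSimplex.exists_leftInv f (Fin.last n)
  exact ⟨mk g, mk_mul_mk m⟩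

noncomputable instance [KanComplex K] {x : K _⦋0⦌} : Inv (KanPi K (n + 1) x) :=
  ⟨fun a ↦ (exists_inv a).choose⟩

/-- The usual group structure on the homotopy groups of a Kan complex. -/
noncomputable instance [KanComplex K] {x : K _⦋0⦌} : Group (KanPi K (n + 1) x) :=
  Group.ofLeftAxioms
    (by
      intro a b c
      obtain ⟨f, rfl⟩ := mk_surjective a
      obtain ⟨g, rfl⟩ := mk_surjective b
      obtain ⟨h, rfl⟩ := mk_surjective c
      obtain ⟨fg, ⟨m₁⟩⟩ := PtSimplex.exists_mulStruct f g (Fin.last n)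
      obtain ⟨gh, ⟨m₂⟩⟩ := PtSimplex.exists_mulStruct g h (Fin.last n)
      obtain ⟨fgh, ⟨m₃⟩⟩ := PtSimplex.exists_mulStruct fg h (Fin.last n)
      obtain ⟨m₄⟩ := PtSimplex.mulStruct_assoc m₁ m₂ m₃
      rw [mk_mul_mk m₁, mk_mul_mk m₂, mk_mul_mk m₃, mk_mul_mk m₄])
    (by
      intro a
      obtain ⟨f, rfl⟩ := mk_surjective a
      exact mk_mul_mk (PtSimplex.MulStruct.oneMul f (Fin.last n)))
    (fun a ↦ (exists_inv a).choose_spec)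

lemma map_comp {M : SSet.{u}} (φ : K ⟶ L) (ψ : L ⟶ M) {x : K _⦋0⦌} {y : L _⦋0⦌} {z : M _⦋0⦌}
    (h : φ.app _ x = y) (h' : ψ.app _ y = z) (h'' : (φ ≫ ψ).app _ x = z) (a : KanPi K n x) :
    map ψ h' (map φ h a) = map (φ ≫ ψ) h'' a := by
  obtain ⟨f, rfl⟩ := mk_surjective a
  rfl

lemma map_id {x : K _⦋0⦌} (a : KanPi K n x) : map (𝟙 K) rfl a = a := by
  obtain ⟨f, rfl⟩ := mk_surjective a
  rfl

/-- Morphisms which are homotopic relative to the base point induce the same map. -/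
lemma map_eq_of_homotopy (φ ψ : K ⟶ L) {x : K _⦋0⦌} {y : L _⦋0⦌}
    (h : φ.app _ x = y) (h' : ψ.app _ x = y) (H : Δ[1] ⊗ K ⟶ L)
    (h0 : endIncl K 0 ≫ H = φ) (h1 : endIncl K 1 ≫ H = ψ)
    (hx : Δ[1] ◁ const (X := Δ[0]) x ≫ H = const y) (a : KanPi K n x) :
    map φ h a = map ψ h' a := by
  obtain ⟨f, rfl⟩ := mk_surjective a
  have H' : RelativeMorphism.Homotopy (RelativeMorphism.ofSimplex₀ φ x y h)
      (RelativeMorphism.ofSimplex₀ ψ x y h') :=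
    { h := (β_ _ _).hom ≫ H
      h₀ := by
        change _ = φ
        rw [← h0]; rfl
      h₁ := by
        change _ = ψ
        rw [← h1]; rfl
      rel := by
        rw [Subcomplex.ofSimplex_ι, BraidedCategory.braiding_naturality_left_assoc]
        have e : (const x : (Subcomplex.ofSimplex x : SSet) ⟶ K) =
          (const (stdSimplex.obj₀Equiv.symm 0) : _ ⟶ Δ[0]) ≫ const x := rfl
        rw [e, whiskerLeft_comp, Category.assoc, hx]
        rfl }
  exact (H'.precomp f rfl).eq

/-- The homotopy set of a product is the product of the homotopy sets. -/
lemma bijective_prod (x : K _⦋0⦌) (y : L _⦋0⦌) :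
    Function.Bijective (fun c : KanPi (K ⊗ L) n (pairVertex x y) ↦
      ((map (fst K L) rfl c : KanPi K n x), (map (snd K L) rfl c : KanPi L n y))) := by
  let pair (f : K.PtSimplex n x) (g : L.PtSimplex n y) :
      (K ⊗ L).PtSimplex n (pairVertex x y) :=
    { map := lift f.map g.map
      comm := by rw [comp_lift, f.comm, g.comm]; rfl }
  have hpair {f f' : K.PtSimplex n x} {g g' : L.PtSimplex n y}
      (H : RelativeMorphism.Homotopy f f') (H' : RelativeMorphism.Homotopy g g') :
      RelativeMorphism.Homotopy (pair f g) (pair f' g') :=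
    { h := lift H.h H'.h
      h₀ := by rw [comp_lift, H.h₀, H'.h₀]
      h₁ := by rw [comp_lift, H.h₁, H'.h₁]
      rel := by rw [comp_lift, H.rel, H'.rel]; rfl }
  let inv (a : KanPi K n x) (b : KanPi L n y) :
      KanPi (K ⊗ L) n (pairVertex x y) :=
    Quot.lift₂ (fun f g ↦ mk (pair f g))
      (fun f _ _ hg ↦ (hpair (.refl f) hg.some).eq)
      (fun _ _ g hf ↦ (hpair hf.some (.refl g)).eq) a b
  refine Function.bijective_iff_has_inverse.2 ⟨fun c ↦ inv c.1 c.2, fun c ↦ ?_, fun ⟨a, b⟩ ↦ ?_⟩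
  · obtain ⟨f, rfl⟩ := mk_surjective c
    change mk (pair _ _) = mk f
    congr 1
  · obtain ⟨f, rfl⟩ := mk_surjective a
    obtain ⟨g, rfl⟩ := mk_surjective b
    rfl

end KanPi


/-- A functorial factorization of the morphisms of simplicial sets as an anodyne extension
followed by a Kan fibration, given by the small object argument. -/
noncomputable def anodyneFactorization :
    MorphismProperty.FunctorialFactorizationData
      modelCategoryQuillen.J.{u}.rlp.llp modelCategoryQuillen.J.{u}.rlp :=
  MorphismProperty.functorialFactorizationData _ _

/-- The morphisms to the terminal object, as a functor to the category of arrows. -/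
noncomputable def toTerminal : SSet.{u} ⥤ Arrow SSet.{u} where
  obj X := Arrow.mk (terminal.from X)
  map f := Arrow.homMk f (𝟙 _) (by simp)

/-- The fibrant replacement functor: the factorization of `X ⟶ *` as an anodyne extension
`X ⟶ fibRepl.obj X` followed by a Kan fibration `fibRepl.obj X ⟶ *`. -/
noncomputable def fibRepl : SSet.{u} ⥤ SSet.{u} := toTerminal ⋙ anodyneFactorization.Z

/-- The natural map from a simplicial set to its fibrant replacement. -/
noncomputable def toFibRepl : 𝟭 SSet.{u} ⟶ fibRepl where
  app X := anodyneFactorization.i.app (toTerminal.obj X)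
  naturality _ _ f := anodyneFactorization.i.naturality (toTerminal.map f)

lemma anodyneExtensions_toFibRepl (X : SSet.{u}) : anodyneExtensions (toFibRepl.app X) :=
  anodyneFactorization.hi _

open modelCategoryQuillen in
instance (X : SSet.{u}) : KanComplex (fibRepl.obj X) := by
  refine (isFibrant_iff_of_isTerminal (anodyneFactorization.p.app (toTerminal.obj X))
    terminalIsTerminal).2 ((fibration_iff _).2 ?_)
  exact anodyneFactorization.hp _

/-- The `n`-th homotopy set `π_n(X, x)` of a simplicial set `X` at a vertex `x`, defined as that
of the fibrant replacement of `X`. For `n ≥ 1` it is a group. -/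
def HomotopyPi (X : SSet.{u}) (n : ℕ) (x : X _⦋0⦌) : Type u :=
  KanPi (fibRepl.obj X) n ((toFibRepl.app X).app _ x)

lemma kanComplex_tensor (K L : SSet.{u}) [KanComplex K] [KanComplex L] : KanComplex (K ⊗ L) := by
  rw [KanComplex.iff]
  intro n i f hf
  have h (M : SSet.{u}) (p : K ⊗ L ⟶ M) : horn.IsCompatible (fun j hj ↦ f j hj ≫ p) := by
    obtain _ | n := n
    · simp
    · rw [horn.isCompatible_iff] at hf ⊢
      intro j k hj hk hjk
      rw [← Category.assoc, ← Category.assoc, hf j k hj hk hjk]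
  obtain ⟨φ, hφ⟩ := (h K (fst K L)).exists_lift_of_kanComplex
  obtain ⟨ψ, hψ⟩ := (h L (snd K L)).exists_lift_of_kanComplex
  refine ⟨lift φ ψ, fun j hj ↦ ?_⟩
  apply CartesianMonoidalCategory.hom_ext
  · rw [Category.assoc, lift_fst, hφ]
  · rw [Category.assoc, lift_snd, hψ]

namespace HomotopyPi

variable {X Y : SSet.{u}} {n : ℕ}

/-- The usual group structure on the homotopy groups. -/
noncomputable instance {x : X _⦋0⦌} : Group (HomotopyPi X (n + 1) x) :=
  inferInstanceAs (Group (KanPi (fibRepl.obj X) (n + 1) ((toFibRepl.app X).app _ x)))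

lemma fibRepl_map_vertex (φ : X ⟶ Y) {x : X _⦋0⦌} {y : Y _⦋0⦌} (h : φ.app _ x = y) :
    (fibRepl.map φ).app _ ((toFibRepl.app X).app _ x) = (toFibRepl.app Y).app _ y := by
  subst h
  exact (ConcreteCategory.congr_hom (congr_app (toFibRepl.naturality φ) _) x).symm

/-- The functoriality of homotopy groups: the map `π_n(X, x) → π_n(Y, y)` induced by a
morphism which sends `x` to `y`. -/
noncomputable def map (φ : X ⟶ Y) {x : X _⦋0⦌} {y : Y _⦋0⦌} (h : φ.app _ x = y)
    (a : HomotopyPi X n x) : HomotopyPi Y n y :=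
  KanPi.map (fibRepl.map φ) (fibRepl_map_vertex φ h) a

lemma bijective_prod (x : X _⦋0⦌) (y : Y _⦋0⦌) :
    Function.Bijective (fun c : HomotopyPi (X ⊗ Y) n (pairVertex x y) ↦
      ((map (fst X Y) rfl c : HomotopyPi X n x), (map (snd X Y) rfl c : HomotopyPi Y n y))) := by
  have := kanComplex_tensor (fibRepl.obj X) (fibRepl.obj Y)
  let z : (X ⊗ Y) _⦋0⦌ := pairVertex x y
  let j := toFibRepl.app (X ⊗ Y)
  let k : X ⊗ Y ⟶ fibRepl.obj X ⊗ fibRepl.obj Y := toFibRepl.app X ⊗ₘ toFibRepl.app Y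
  let f : fibRepl.obj (X ⊗ Y) ⟶ fibRepl.obj X ⊗ fibRepl.obj Y :=
    lift (fibRepl.map (fst X Y)) (fibRepl.map (snd X Y))
  have hj : anodyneExtensions j := anodyneExtensions_toFibRepl _
  have hk : anodyneExtensions k := by
    have : k = toFibRepl.app X ▷ Y ≫ fibRepl.obj X ◁ toFibRepl.app Y := by
      simp only [k, MonoidalCategory.tensorHom_def]
    rw [this]
    exact MorphismProperty.comp_mem _ _ _
      (anodyneExtensions.whiskerRight (anodyneExtensions_toFibRepl X) _)
      (anodyneExtensions.whiskerLeft (anodyneExtensions_toFibRepl Y) _)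
  have hf : j ≫ f = k := by
    apply CartesianMonoidalCategory.hom_ext
    · simp only [f, k, Category.assoc, lift_fst, tensorHom_fst]
      exact (toFibRepl.naturality (fst X Y)).symm
    · simp only [f, k, Category.assoc, lift_snd, tensorHom_snd]
      exact (toFibRepl.naturality (snd X Y)).symm
  have sq : CommSq j k (terminal.from _) (terminal.from _) := ⟨by simp⟩
  have : HasLiftingProperty k (terminal.from (fibRepl.obj (X ⊗ Y))) := hk _ (by
    rw [← HomotopicalAlgebra.fibration_iff]; infer_instance)
  obtain ⟨g, hg⟩ : ∃ g, k ≫ g = j := ⟨sq.lift, sq.fac_left⟩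
  have key {A B : SSet.{u}} [KanComplex B] (i : A ⟶ B) (hi : anodyneExtensions i) (v : B ⟶ B)
      (hv : i ≫ v = i) (a₀ : A _⦋0⦌) (h : v.app _ (i.app _ a₀) = i.app _ a₀)
      (c : KanPi B n (i.app _ a₀)) : KanPi.map v h c = c := by
    obtain ⟨H, hH, h0, h1⟩ := exists_homotopy_extension i hi v (𝟙 B) (snd _ _ ≫ i)
      (by rw [hv]; rfl) (by rw [Category.comp_id]; rfl)
    refine (KanPi.map_eq_of_homotopy v (𝟙 B) h rfl H h0 h1 ?_ c).trans (KanPi.map_id c)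
    have e : (const (i.app _ a₀) : Δ[0] ⟶ B) = const a₀ ≫ i := by rw [const_comp]
    rw [e, whiskerLeft_comp, Category.assoc, hH, whiskerLeft_snd_assoc, const_comp]
    rfl
  have hfz : f.app _ (j.app _ z) = k.app _ z := by rw [← hf]; rfl
  have hgz : g.app _ (k.app _ z) = j.app _ z := by rw [← hg]; rfl
  have hbij : Function.Bijective (fun c : KanPi _ n (j.app _ z) ↦ KanPi.map f hfz c) := by
    refine Function.bijective_iff_has_inverse.2 ⟨KanPi.map g hgz, fun c ↦ ?_, fun c ↦ ?_⟩
    · have h : (f ≫ g).app _ (j.app _ z) = j.app _ z := by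
        rw [NatTrans.comp_app_apply, hfz, hgz]
      exact (KanPi.map_comp f g hfz hgz h c).trans
        (key j hj (f ≫ g) (by rw [← Category.assoc, hf, hg]) z h c)
    · have h : (g ≫ f).app _ (k.app _ z) = k.app _ z := by
        rw [NatTrans.comp_app_apply, hgz, hfz]
      exact (KanPi.map_comp g f hgz hfz h c).trans
        (key k hk (g ≫ f) (by rw [← Category.assoc, hg, hf]) z h c)
  have hprod := KanPi.bijective_prod (n := n) ((toFibRepl.app X).app _ x)
    ((toFibRepl.app Y).app _ y)
  have hcomp := hprod.comp hbij
  have heq : (fun c : HomotopyPi (X ⊗ Y) n (pairVertex x y) ↦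
      ((map (fst X Y) rfl c : HomotopyPi X n x), (map (snd X Y) rfl c : HomotopyPi Y n y))) =
      (fun c : KanPi (fibRepl.obj X ⊗ fibRepl.obj Y) n
        (pairVertex ((toFibRepl.app X).app _ x) ((toFibRepl.app Y).app _ y)) ↦
        (KanPi.map (fst _ _) rfl c, KanPi.map (snd _ _) rfl c)) ∘
        (fun c : KanPi _ n (j.app _ z) ↦ KanPi.map f hfz c) := by
    funext c
    obtain ⟨c, rfl⟩ := KanPi.mk_surjective c
    refine Prod.ext ?_ ?_
    · change KanPi.mk _ = KanPi.mk _
      congr 1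
    · change KanPi.mk _ = KanPi.mk _
      congr 1
  rw [heq]
  exact hcomp

/-- The canonical bijection `π_n(X × Y, (x, y)) ≃ π_n(X, x) × π_n(Y, y)`, whose components are
induced by the two projections. -/
noncomputable def prodEquiv (x : X _⦋0⦌) (y : Y _⦋0⦌) :
    HomotopyPi (X ⊗ Y) n (pairVertex x y) ≃ HomotopyPi X n x × HomotopyPi Y n y :=
  Equiv.ofBijective (fun c ↦ (map (fst X Y) rfl c, map (snd X Y) rfl c)) (bijective_prod x y)

end HomotopyPi

end
end SSet
/-- A semigroup `(S, +)` is inverse if for every `x` there is a unique `y` such that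
`x + y + x = x` and `y + x + y = y`. -/
def IsInverseAddSemigroup (S : Type u) [AddSemigroup S] : Prop :=
  ∀ x : S, ∃! y : S, x + y + x = x ∧ y + x + y = y

/-- A commutative simplicial inverse semigroup: a simplicial object in the category of semigroups
which is, in each degree, commutative and inverse. -/
structure IsCommInverse (S : SimplicialObject AddSemigrp.{u}) : Prop where
  add_comm (k : ℕ) (x y : S _⦋k⦌) : x + y = y + x
  isInverse (k : ℕ) : IsInverseAddSemigroup (S _⦋k⦌)

namespace SimplicialSemigroup
section
open MonoidalCategory CartesianMonoidalCategory SSet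

/-- The underlying simplicial set of a simplicial semigroup. -/
abbrev toSSet (S : SimplicialObject AddSemigrp.{u}) : SSet.{u} := S ⋙ forget AddSemigrp.{u}

/-- The law `S × S ⟶ S` of a simplicial semigroup, as a morphism of simplicial sets. -/
def lawHom (S : SimplicialObject AddSemigrp.{u}) : toSSet S ⊗ toSSet S ⟶ toSSet S where
  app m := ↾fun z ↦ (show S.obj m from z.1) + (show S.obj m from z.2)
  naturality m m' f := by
    ext z
    exact (map_add (S.map f).hom (show S.obj m from z.1) (show S.obj m from z.2)).symm

/-- The law induced on `π_n(S, e)` by the law of `S`, when `e` is an idempotent: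
the composite `π_n(S, e) × π_n(S, e) ≃ π_n(S × S, (e, e)) → π_n(S, e + e) = π_n(S, e)`. -/
noncomputable def inducedLaw (S : SimplicialObject AddSemigrp.{u}) {e : S _⦋0⦌} (he : e + e = e)
    (n : ℕ) (a b : HomotopyPi (toSSet S) n e) : HomotopyPi (toSSet S) n e :=
  HomotopyPi.map (x := pairVertex (X := toSSet S) (Y := toSSet S) e e) (lawHom S) he
    ((HomotopyPi.prodEquiv (X := toSSet S) (Y := toSSet S) e e).symm (a, b))

end
end SimplicialSemigroup

/-!
The argument is a refinement of that of Eckmann and Hilton. Write `⊞` for the induced law.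
Morphisms of simplicial sets induce group homomorphisms on homotopy groups, so that `⊞`, which is
induced by `S × S ⟶ S`, satisfies the interchange law
`(a * b) ⊞ (c * d) = (a ⊞ c) * (b ⊞ d)` (`inducedLaw_mul_mul`). As `⊞` is commutative, this gives
`a ⊞ b = φ a * φ b` for the endomorphism `φ a = a ⊞ 1`, and it remains to see that `φ` is the
identity, i.e. that the neutral element of the homotopy group is neutral for `⊞` although `e` is
not neutral in `S`.

* Identities between sums of endomorphisms of the simplicial set `S` pass to the homotopy groups
  (`inducedLaw_map_map`). As `1` is the image of any class under the constant map
  `e`, the map `φ` is induced by `x ↦ x + e`, hence `φ (φ a) = φ a`, since `e + e = e`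
  (`inducedLaw_one_one`).
* By uniqueness, `x ↦ x^*` commutes with the simplicial structure and fixes `e`, so it acts on the
  homotopy group, and `x + x^* + x = x` yields
  `a = (a ⊞ a^*) ⊞ a = φ (a ⊞ a^*) * φ a = φ ((a ⊞ a^*) * a)` (`exists_inducedLaw_eq`).

So `a` is in the image of the idempotent endomorphism `φ`, i.e. `φ a = a`.
-/

namespace SSet

open MonoidalCategory CartesianMonoidalCategory

/-- The image of a `MulStruct` under a morphism of simplicial sets. -/
def PtSimplex.MulStruct.postcomp {K L : SSet.{u}} {n : ℕ} {x : K _⦋0⦌} {y : L _⦋0⦌}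
    {f g fg : K.PtSimplex n x} {i : Fin n} (m : PtSimplex.MulStruct f g fg i)
    (φ : K ⟶ L) (h : φ.app _ x = y) :
    PtSimplex.MulStruct
      (RelativeMorphism.comp f (RelativeMorphism.ofSimplex₀ φ x y h) rfl : L.PtSimplex n y)
      (RelativeMorphism.comp g (RelativeMorphism.ofSimplex₀ φ x y h) rfl)
      (RelativeMorphism.comp fg (RelativeMorphism.ofSimplex₀ φ x y h) rfl) i where
  map := m.map ≫ φ
  δ_castSucc_castSucc_map := by rw [← Category.assoc, m.δ_castSucc_castSucc_map]; rfl
  δ_succ_castSucc_map := by rw [← Category.assoc, m.δ_succ_castSucc_map]; rfl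
  δ_succ_succ_map := by rw [← Category.assoc, m.δ_succ_succ_map]; rfl
  δ_map_of_lt j hj := by rw [← Category.assoc, m.δ_map_of_lt j hj, const_comp, h]
  δ_map_of_gt j hj := by rw [← Category.assoc, m.δ_map_of_gt j hj, const_comp, h]

lemma KanPi.map_mul {K L : SSet.{u}} [KanComplex K] [KanComplex L] {n : ℕ} {x : K _⦋0⦌}
    {y : L _⦋0⦌} (φ : K ⟶ L) (h : φ.app _ x = y) (a b : KanPi K (n + 1) x) :
    map φ h (a * b) = map φ h a * map φ h b := by
  obtain ⟨f, rfl⟩ := mk_surjective a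
  obtain ⟨g, rfl⟩ := mk_surjective b
  obtain ⟨fg, ⟨m⟩⟩ := PtSimplex.exists_mulStruct f g (Fin.last n)
  rw [mk_mul_mk m]
  exact (mk_mul_mk (m.postcomp φ h)).symm

namespace HomotopyPi

variable {X Y Z : SSet.{u}} {n : ℕ}

lemma map_mul (φ : X ⟶ Y) {x : X _⦋0⦌} {y : Y _⦋0⦌} (h : φ.app _ x = y)
    (a b : HomotopyPi X (n + 1) x) : map φ h (a * b) = map φ h a * map φ h b :=
  KanPi.map_mul _ _ a b

lemma map_one (φ : X ⟶ Y) {x : X _⦋0⦌} {y : Y _⦋0⦌} (h : φ.app _ x = y) :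
    map φ h (1 : HomotopyPi X (n + 1) x) = 1 :=
  _root_.map_one (MonoidHom.mk' (map φ h) (map_mul φ h))

lemma map_comp (φ : X ⟶ Y) (ψ : Y ⟶ Z) {x : X _⦋0⦌} {y : Y _⦋0⦌} {z : Z _⦋0⦌}
    (h : φ.app _ x = y) (h' : ψ.app _ y = z) (h'' : (φ ≫ ψ).app _ x = z)
    (a : HomotopyPi X n x) : map ψ h' (map φ h a) = map (φ ≫ ψ) h'' a := by
  obtain ⟨f, rfl⟩ := KanPi.mk_surjective a
  unfold map
  rw [KanPi.map_comp _ _ _ _ (by rw [← Functor.map_comp]; exact fibRepl_map_vertex _ h'')]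
  congr 1
  exact (fibRepl.map_comp φ ψ).symm

lemma map_congr {φ ψ : X ⟶ Y} (e : φ = ψ) {x : X _⦋0⦌} {y : Y _⦋0⦌} (h : φ.app _ x = y)
    (h' : ψ.app _ x = y) (a : HomotopyPi X n x) : map φ h a = map ψ h' a := by
  subst e
  rfl

lemma map_id {x : X _⦋0⦌} (h : (𝟙 X : X ⟶ X).app _ x = x) (a : HomotopyPi X n x) :
    map (𝟙 X) h a = a := by
  obtain ⟨f, rfl⟩ := KanPi.mk_surjective a
  unfold map
  refine Eq.trans ?_ (KanPi.map_id _)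
  congr 1
  exact fibRepl.map_id X

/-- As the two projections of `Δ[0] ⊗ Δ[0]` are equal, any two classes of `Δ[0]`, being the
components of a class of the product, are equal. -/
instance (x : (Δ[0] : SSet.{u}) _⦋0⦌) : Subsingleton (HomotopyPi (Δ[0] : SSet.{u}) n x) where
  allEq a b := by
    obtain ⟨c, hc⟩ := (bijective_prod x x).2 (a, b)
    exact (congrArg Prod.fst hc).symm.trans
      ((map_congr (stdSimplex.isTerminalObj₀.hom_ext (fst _ _) (snd _ _)) rfl rfl c).trans (congrArg Prod.snd hc))

lemma const_app_vertex (x : X _⦋0⦌) (y : Y _⦋0⦌) : (const y : X ⟶ Y).app _ x = y := by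
  have h : ⦋0⦌.const ⦋0⦌ 0 = 𝟙 _ := SimplexCategory.hom_zero_zero _
  change Y.map (⦋0⦌.const ⦋0⦌ 0).op y = y
  rw [h, op_id, Functor.map_id_apply]

/-- A constant morphism factors through `Δ[0]`, whose homotopy groups are trivial. -/
lemma map_const {x : X _⦋0⦌} {y : Y _⦋0⦌} (h : (const y : X ⟶ Y).app _ x = y)
    (a : HomotopyPi X (n + 1) x) : map (const y) h a = 1 := by
  let o : (Δ[0] : SSet.{u}) _⦋0⦌ := stdSimplex.obj₀Equiv.symm 0
  have h' : (const y : Δ[0] ⟶ Y).app _ o = y := const_app_vertex o y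
  refine (map_comp (const o : X ⟶ Δ[0]) (const y) (const_app_vertex x o) h' h a).symm.trans ?_
  exact (congrArg _ (Subsingleton.elim _ 1)).trans (map_one _ h')

lemma prodEquiv_map_lift (φ : Z ⟶ X) (ψ : Z ⟶ Y) {z : Z _⦋0⦌} {x : X _⦋0⦌} {y : Y _⦋0⦌}
    (h : φ.app _ z = x) (h' : ψ.app _ z = y) (h'' : (lift φ ψ).app _ z = pairVertex x y)
    (c : HomotopyPi Z n z) :
    prodEquiv x y (map (lift φ ψ) h'' c) = (map φ h c, map ψ h' c) :=
  Prod.ext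
    ((map_comp (lift φ ψ) (fst X Y) h'' rfl (by rw [lift_fst]; exact h) c).trans
      (map_congr (lift_fst _ _) _ h c))
    ((map_comp (lift φ ψ) (snd X Y) h'' rfl (by rw [lift_snd]; exact h') c).trans
      (map_congr (lift_snd _ _) _ h' c))

lemma prodEquiv_symm_mul (x : X _⦋0⦌) (y : Y _⦋0⦌) (a b : HomotopyPi X (n + 1) x)
    (c d : HomotopyPi Y (n + 1) y) :
    (prodEquiv x y).symm (a * b, c * d) =
      (prodEquiv x y).symm (a, c) * (prodEquiv x y).symm (b, d) := by
  rw [Equiv.symm_apply_eq]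
  have h (p q : HomotopyPi (X ⊗ Y) (n + 1) (pairVertex x y)) :
      prodEquiv x y (p * q) = prodEquiv x y p * prodEquiv x y q :=
    Prod.ext (map_mul (fst X Y) rfl p q) (map_mul (snd X Y) rfl p q)
  rw [h, Equiv.apply_symm_apply, Equiv.apply_symm_apply]
  rfl

end HomotopyPi

end SSet

namespace IsInverseAddSemigroup

variable {M N : Type u} [AddSemigroup M] [AddSemigroup N]

/-- The inverse `x^*` of an element of an inverse semigroup. -/
noncomputable def star (hM : IsInverseAddSemigroup M) (x : M) : M := (hM x).choose

lemma add_star_add (hM : IsInverseAddSemigroup M) (x : M) : x + hM.star x + x = x :=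
  (hM x).choose_spec.1.1

lemma star_add_star (hM : IsInverseAddSemigroup M) (x : M) :
    hM.star x + x + hM.star x = hM.star x :=
  (hM x).choose_spec.1.2

lemma eq_star (hM : IsInverseAddSemigroup M) {x y : M} (h : x + y + x = x) (h' : y + x + y = y) :
    y = hM.star x :=
  (hM x).choose_spec.2 y ⟨h, h'⟩

lemma star_of_idempotent (hM : IsInverseAddSemigroup M) {x : M} (h : x + x = x) :
    hM.star x = x :=
  (hM.eq_star (by rw [h, h]) (by rw [h, h])).symm

lemma map_star (hM : IsInverseAddSemigroup M) (hN : IsInverseAddSemigroup N) (f : M →ₙ+ N)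
    (x : M) : f (hM.star x) = hN.star (f x) :=
  hN.eq_star (by rw [← map_add, ← map_add, hM.add_star_add])
    (by rw [← map_add, ← map_add, hM.star_add_star])

end IsInverseAddSemigroup

namespace SimplicialSemigroup

open MonoidalCategory CartesianMonoidalCategory SSet

variable {S : SimplicialObject AddSemigrp.{u}}

/-- The morphism of simplicial sets `x ↦ x^*` of a simplicial inverse semigroup. -/
noncomputable def starHom (hS : ∀ m, IsInverseAddSemigroup (S.obj m)) : toSSet S ⟶ toSSet S where
  app m := ↾fun x ↦ (hS m).star (show S.obj m from x)
  naturality m m' f := by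
    ext x
    exact ((hS m).map_star (hS m') (S.map f).hom x).symm

lemma lift_lift_starHom_lawHom (hS : ∀ m, IsInverseAddSemigroup (S.obj m)) :
    lift (lift (𝟙 _) (starHom hS) ≫ lawHom S) (𝟙 _) ≫ lawHom S = 𝟙 _ := by
  ext m x
  exact (hS m).add_star_add x

lemma lift_snd_fst_lawHom (hS : IsCommInverse S) :
    lift (snd _ _) (fst _ _) ≫ lawHom S = lawHom S := by
  ext m z
  exact hS.add_comm m.unop.len z.2 z.1

variable {e : S _⦋0⦌} {n : ℕ}

/-- The morphism of simplicial sets `x ↦ x + e`, where `e` stands in each degree for its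
degeneracy. -/
def addVertexHom (e : S _⦋0⦌) : toSSet S ⟶ toSSet S :=
  lift (𝟙 _) (const (Y := toSSet S) e) ≫ lawHom S

lemma addVertexHom_comp_self (he : e + e = e) :
    addVertexHom e ≫ addVertexHom e = addVertexHom e := by
  ext m x
  let d : S.obj m := S.map (m.unop.const ⦋0⦌ 0).op e
  have hd : d + d = d := by
    rw [← map_add, he]
  change (show S.obj m from x) + d + d = (show S.obj m from x) + d
  rw [add_assoc, hd]

/-- The induced law computes the effect on homotopy groups of a sum of two morphisms. -/
lemma inducedLaw_map_map (he : e + e = e) {X : SSet.{u}} {x : X _⦋0⦌} (φ ψ : X ⟶ toSSet S)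
    (h : φ.app _ x = e) (h' : ψ.app _ x = e) (h'' : (lift φ ψ ≫ lawHom S).app _ x = e)
    (c : HomotopyPi X n x) :
    inducedLaw S he n (HomotopyPi.map φ h c) (HomotopyPi.map ψ h' c) =
      HomotopyPi.map (lift φ ψ ≫ lawHom S) h'' c := by
  have hp : (lift φ ψ).app _ x = pairVertex (X := toSSet S) (Y := toSSet S) e e := Prod.ext h h'
  unfold inducedLaw
  rw [← HomotopyPi.prodEquiv_map_lift φ ψ h h' hp, Equiv.symm_apply_apply]
  exact HomotopyPi.map_comp (lift φ ψ) (lawHom S) hp he h'' c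

lemma inducedLaw_comm (hS : IsCommInverse S) (he : e + e = e)
    (a b : HomotopyPi (toSSet S) n e) : inducedLaw S he n a b = inducedLaw S he n b a := by
  obtain ⟨c, hc⟩ := (HomotopyPi.prodEquiv (X := toSSet S) (Y := toSSet S) e e).surjective (b, a)
  obtain ⟨hb, ha⟩ := Prod.ext_iff.1 hc
  have h : (lift (snd _ _) (fst _ _) ≫ lawHom S).app _
      (pairVertex (X := toSSet S) (Y := toSSet S) e e) = e := he
  have key := inducedLaw_map_map he (snd _ _) (fst _ _) rfl rfl h c
  rw [HomotopyPi.map_congr (lift_snd_fst_lawHom hS) h he] at key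
  dsimp only at ha hb
  rw [← ha, ← hb]
  refine key.trans ?_
  unfold inducedLaw
  congr 1
  exact ((Equiv.symm_apply_eq _).2 rfl).symm

/-- The interchange law between the induced law and the group law. -/
lemma inducedLaw_mul_mul (he : e + e = e) (a b c d : HomotopyPi (toSSet S) (n + 1) e) :
    inducedLaw S he (n + 1) (a * b) (c * d) =
      inducedLaw S he (n + 1) a c * inducedLaw S he (n + 1) b d := by
  unfold inducedLaw
  rw [HomotopyPi.prodEquiv_symm_mul]
  exact HomotopyPi.map_mul (lawHom S) he _ _

lemma inducedLaw_eq_mul (hS : IsCommInverse S) (he : e + e = e)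
    (a b : HomotopyPi (toSSet S) (n + 1) e) :
    inducedLaw S he (n + 1) a b = inducedLaw S he (n + 1) a 1 * inducedLaw S he (n + 1) b 1 := by
  rw [inducedLaw_comm hS he b, ← inducedLaw_mul_mul, mul_one, one_mul]

lemma inducedLaw_one (he : e + e = e) (a : HomotopyPi (toSSet S) (n + 1) e)
    (h : (addVertexHom e).app _ e = e) :
    inducedLaw S he (n + 1) a 1 = HomotopyPi.map (addVertexHom e) h a := by
  have hc := HomotopyPi.const_app_vertex (X := toSSet S) (Y := toSSet S) e e
  have hid : (𝟙 (toSSet S) : toSSet S ⟶ _).app _ e = e := rfl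
  have key := inducedLaw_map_map he (𝟙 (toSSet S)) (const (Y := toSSet S) e) hid hc h a
  rwa [HomotopyPi.map_id, HomotopyPi.map_const] at key

lemma inducedLaw_one_one (he : e + e = e) (a : HomotopyPi (toSSet S) (n + 1) e) :
    inducedLaw S he (n + 1) (inducedLaw S he (n + 1) a 1) 1 = inducedLaw S he (n + 1) a 1 := by
  have h : (addVertexHom e).app _ e = e :=
    (congrArg (e + ·) (HomotopyPi.const_app_vertex (X := toSSet S) (Y := toSSet S) e e)).trans he
  have h2 : (addVertexHom e ≫ addVertexHom e).app _ e = e := by rwa [addVertexHom_comp_self he]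
  rw [inducedLaw_one he _ h, inducedLaw_one he _ h, HomotopyPi.map_comp _ _ h h h2,
    HomotopyPi.map_congr (addVertexHom_comp_self he) h2 h]

/-- The class `b` is `a ⊞ a^*`, by the identity `x + x^* + x = x`. -/
lemma exists_inducedLaw_eq (hS : IsCommInverse S) (he : e + e = e)
    (a : HomotopyPi (toSSet S) n e) : ∃ b, inducedLaw S he n b a = a := by
  have hI (m) : IsInverseAddSemigroup (S.obj m) := hS.isInverse m.unop.len
  have hs : (starHom hI).app _ e = e := (hI _).star_of_idempotent he
  have h₁ : (lift (𝟙 _) (starHom hI) ≫ lawHom S).app _ e = e :=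
    (congrArg (e + ·) hs).trans he
  have h₂ := lift_lift_starHom_lawHom hI
  have h₃ : (lift (lift (𝟙 _) (starHom hI) ≫ lawHom S) (𝟙 _) ≫ lawHom S).app _ e = e := by
    rw [h₂]; rfl
  have hid : (𝟙 (toSSet S) : toSSet S ⟶ _).app _ e = e := rfl
  have key := inducedLaw_map_map he _ (𝟙 (toSSet S)) h₁ hid h₃ a
  rw [HomotopyPi.map_congr h₂ h₃ hid, HomotopyPi.map_id] at key
  exact ⟨_, key⟩

/-- The map `a ↦ a ⊞ 1` is an idempotent endomorphism, and it is surjective since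
`a = b ⊞ a = (b * a) ⊞ 1` for some `b`; so it is the identity. -/
lemma inducedLaw_one_eq (hS : IsCommInverse S) (he : e + e = e)
    (a : HomotopyPi (toSSet S) (n + 1) e) : inducedLaw S he (n + 1) a 1 = a := by
  obtain ⟨b, hb⟩ := exists_inducedLaw_eq hS he a
  have h := inducedLaw_one_one he (b * a)
  have h1 := inducedLaw_mul_mul he b a 1 1
  rw [mul_one, ← inducedLaw_eq_mul hS, hb] at h1
  rwa [h1] at h

end SimplicialSemigroup

theorem proposition5p3 (S : SimplicialObject AddSemigrp.{u}) (hS : IsCommInverse S)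
    (e : S _⦋0⦌) (he : e + e = e) (n : ℕ)
    (a b : SSet.HomotopyPi (SimplicialSemigroup.toSSet S) (n + 1) e) :
    SimplicialSemigroup.inducedLaw S he (n + 1) a b = a * b := by
  rw [SimplicialSemigroup.inducedLaw_eq_mul hS, SimplicialSemigroup.inducedLaw_one_eq hS,
    SimplicialSemigroup.inducedLaw_one_eq hS]
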